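/- For $c>0$ let $\mathcal L_{[0,c]}$ denote the normalized Lebesgue measure on $[0,c]$, i.e. $\mathcal L_{[0,c]}(F)=\mathcal L([0,c]\cap F)/c$. For a sequence $\mathcal N=\{N_k\}_{k\ge1}$ of integers $N_k\ge 2$ put $$\nu_k=\frac1{N_k}\sum_{j=0}^{N_k-1}\delta_{j/(N_1N_2\cdots N_k)},\qquad k\ge1 .$$ (Infinite convolutions below are weak limits of the finite partial convolutions.) A pair $(\mu,\nu)$ of Borel probability measures supported on $[0,1]$ with $\mu*\nu=\mathcal L_{[0,1]}$ is called a natural complementary pair if for some such sequence $\mathcal N$ one of the following holds. Type I: there is an integer $k\ge1$ such that either $$\mu=\nu_1*\nu_3*\cdots*\nu_{2k-1},\qquad \nu=\nu_2*\nu_4*\cdots*\nu_{2k}*\mathcal L_{[0,1/(N_1N_2\cdots N_{2k})]},$$ or $$\mu=\nu_1*\nu_3*\cdots*\nu_{2k-1}*\mathcal L_{[0,1/(N_1N_2\cdots N_{2k})]},\qquad \nu=\nu_2*\nu_4*\cdots*\nu_{2k}.$$ Type II: $\mu=\nu_1*\nu_3*\nu_5*\cdots$ and $\nu=\nu_2*\nu_4*\nu_6*\cdots$.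 **Theorem.** Let $\mu$ and $\nu$ be Borel probability measures on $\mathbb R$ supported on $[0,1]$ with $\mu*\nu=\mathcal L_{[0,1]}$. Then either one of the two measures is $\delta_0$ and the other is $\mathcal L_{[0,1]}$ (the trivial factorization), or $\mu$ and $\nu$ form, in one of the two orders, a natural complementary pair; that is, $(\mu,\nu)$ or $(\nu,\mu)$ is a natural complementary pair. -/

import Mathlib

open MeasureTheory Filter Topology
open scoped ENNReal

noncomputable section

namespace LebesgueFactorization

/-- The normalized Lebesgue measure `𝓛_{[0,c]}` on the interval `[0, c]`,
that is `F ↦ 𝓛([0,c] ∩ F) / 𝓛([0,c])`; it is used for `c > 0` only. -/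
def unif (c : ℝ) : Measure ℝ := ProbabilityTheory.cond volume (Set.Icc 0 c)

/-- The product `N_1 N_2 ⋯ N_k`. The value `N 0` is never used. -/
def scale (N : ℕ → ℕ) (k : ℕ) : ℝ := ∏ i ∈ Finset.Icc 1 k, (N i : ℝ)

/-- The discrete measure `ν_k = (1 / N_k) ∑_{j = 0}^{N_k - 1} δ_{j / (N_1 ⋯ N_k)}`, for `k ≥ 1`. -/
def factor (N : ℕ → ℕ) (k : ℕ) : Measure ℝ :=
  (N k : ℝ≥0∞)⁻¹ • ∑ j ∈ Finset.range (N k), Measure.dirac ((j : ℝ) / scale N k)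

/-- The finite convolution `ρ 0 ∗ ρ 1 ∗ ⋯ ∗ ρ (n - 1)`; the empty convolution is `δ_0`. -/
def finConv (ρ : ℕ → Measure ℝ) : ℕ → Measure ℝ
  | 0 => Measure.dirac 0
  | n + 1 => (finConv ρ n).conv (ρ n)

/-- `m` is the infinite convolution `ρ 0 ∗ ρ 1 ∗ ⋯`: the finite convolutions and `m` are
probability measures, and the finite convolutions converge weakly to `m`. -/
def IsInfiniteConv (ρ : ℕ → Measure ℝ) (m : Measure ℝ) : Prop :=
  ∃ (P : ℕ → ProbabilityMeasure ℝ) (p : ProbabilityMeasure ℝ),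
    (∀ n, (P n : Measure ℝ) = finConv ρ n) ∧ (p : Measure ℝ) = m ∧ Tendsto P atTop (𝓝 p)

/-- The factors `ν_1, ν_3, ν_5, …`. -/
def oddFactor (N : ℕ → ℕ) (i : ℕ) : Measure ℝ := factor N (2 * i + 1)

/-- The factors `ν_2, ν_4, ν_6, …`. -/
def evenFactor (N : ℕ → ℕ) (i : ℕ) : Measure ℝ := factor N (2 * i + 2)

/-- Type I: for some `k ≥ 1`, with `L = 𝓛_{[0, 1 / (N_1 ⋯ N_{2k})]}`, either
`μ = ν_1 ∗ ν_3 ∗ ⋯ ∗ ν_{2k-1}` and `ν = ν_2 ∗ ν_4 ∗ ⋯ ∗ ν_{2k} ∗ L`, or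
`μ = ν_1 ∗ ν_3 ∗ ⋯ ∗ ν_{2k-1} ∗ L` and `ν = ν_2 ∗ ν_4 ∗ ⋯ ∗ ν_{2k}`. -/
def IsTypeI (N : ℕ → ℕ) (μ ν : Measure ℝ) : Prop :=
  ∃ k : ℕ, 1 ≤ k ∧
    ((μ = finConv (oddFactor N) k ∧
        ν = (finConv (evenFactor N) k).conv (unif (1 / scale N (2 * k)))) ∨
      (μ = (finConv (oddFactor N) k).conv (unif (1 / scale N (2 * k))) ∧
        ν = finConv (evenFactor N) k))

/-- Type II: `μ = ν_1 ∗ ν_3 ∗ ν_5 ∗ ⋯` and `ν = ν_2 ∗ ν_4 ∗ ν_6 ∗ ⋯`. -/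
def IsTypeII (N : ℕ → ℕ) (μ ν : Measure ℝ) : Prop :=
  IsInfiniteConv (oddFactor N) μ ∧ IsInfiniteConv (evenFactor N) ν

/-- `(μ, ν)` is a complementary pair with respect to `𝓛_{[0,1]}`. -/
def IsComplementaryPair (μ ν : Measure ℝ) : Prop := μ.conv ν = unif 1

/-- `(μ, ν)` is a natural complementary pair. -/
def IsNaturalComplementaryPair (μ ν : Measure ℝ) : Prop :=
  IsComplementaryPair μ ν ∧
    ∃ N : ℕ → ℕ, (∀ k, 1 ≤ k → 2 ≤ N k) ∧ (IsTypeI N μ ν ∨ IsTypeII N μ ν)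

end LebesgueFactorization

end

/-! Write μ̂(k) for `charFun μ (2 * π * k)`. For k ≠ 0 one has μ̂(k) ν̂(k) = 0. Hence in L²(μ × ν)
the characters e(j(x + y)) are orthonormal, and each is orthogonal to at least one of the centred
coordinates X, Y. Bessel's inequality is an equality for X + Y, the centred uniform variable, and
therefore already for Y. So Y is a function of x + y with known Fourier coefficients: i/(2πj) where
j ≠ 0 and μ̂(j) ≠ 0, and 0 elsewhere. Parseval for Y against Y e(k(x + y)) is
`IsFactorPair.hasSum_fiberCoeff`; when μ̂(k) = 0 it says that the sum of 1/(j(j - k)), over nonzero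
j and j - k in the support of μ̂, vanishes. A sign argument then puts the support of μ̂ inside Nℤ,
where N is its least positive element (`IsFactorPair.dvd_of_charFun_ne_zero`).

Such a μ is a grid of N points convolved with a measure on [0, 1/N). Removing the grid and rescaling
by N gives another factor pair with the roles exchanged (`IsFactorPair.exists_isStep`). Iteration
either reaches δ_0 as second measure, which gives Type I with the alternative fixed by parity, or
never stops, and the shrinking remainders give Type II. Which of μ̂(1), ν̂(1) vanishes decides the
order of the pair. -/

namespace LebesgueFactorization

open scoped InnerProductSpace ComplexConjugate

/-! ### Equality in Bessel's inequality -/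

section Hilbert

variable {E ι : Type*} [NormedAddCommGroup E] [InnerProductSpace ℂ E] {v : ι → E} {x y : E}

/-- If Bessel's inequality is an equality at `x`, then Parseval's identity holds at `x`. -/
theorem hasSum_inner_mul_inner_of_hasSum_sq (hv : Orthonormal ℂ v)
    (hx : HasSum (fun i => ‖⟪v i, x⟫_ℂ‖ ^ 2) (‖x‖ ^ 2)) (w : E) :
    HasSum (fun i => ⟪w, v i⟫_ℂ * ⟪v i, x⟫_ℂ) ⟪w, x⟫_ℂ := by
  -- Pythagoras: the squared distance from `x` to a partial expansion is the Bessel defect, which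
  -- tends to 0.
  have key : ∀ s : Finset ι, ‖x - ∑ i ∈ s, ⟪v i, x⟫_ℂ • v i‖ ^ 2
      = ‖x‖ ^ 2 - ∑ i ∈ s, ‖⟪v i, x⟫_ℂ‖ ^ 2 := by
    intro s
    have h1 : ⟪∑ i ∈ s, ⟪v i, x⟫_ℂ • v i, x⟫_ℂ = ((∑ i ∈ s, ‖⟪v i, x⟫_ℂ‖ ^ 2 : ℝ) : ℂ) := by
      rw [sum_inner]
      push_cast
      refine Finset.sum_congr rfl fun i _ => ?_
      rw [inner_smul_left, Complex.conj_mul']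
    have h2 : ‖∑ i ∈ s, ⟪v i, x⟫_ℂ • v i‖ ^ 2 = ∑ i ∈ s, ‖⟪v i, x⟫_ℂ‖ ^ 2 := by
      have := hv.inner_sum (fun i => ⟪v i, x⟫_ℂ) (fun i => ⟪v i, x⟫_ℂ) s
      rw [inner_self_eq_norm_sq_to_K] at this
      have h3 : ∑ i ∈ s, conj ⟪v i, x⟫_ℂ * ⟪v i, x⟫_ℂ
          = ((∑ i ∈ s, ‖⟪v i, x⟫_ℂ‖ ^ 2 : ℝ) : ℂ) := by
        push_cast
        exact Finset.sum_congr rfl fun i _ => Complex.conj_mul' _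
      rw [h3] at this
      exact Complex.ofReal_injective (by push_cast at this ⊢; exact this)
    rw [@norm_sub_sq ℂ, h2, ← inner_conj_symm, h1, Complex.conj_ofReal, RCLike.re_to_complex,
      Complex.ofReal_re]
    ring
  have hS : HasSum (fun i => ⟪v i, x⟫_ℂ • v i) x := by
    rw [HasSum, tendsto_iff_norm_sub_tendsto_zero]
    have h0 : Tendsto (fun s : Finset ι => ‖x‖ ^ 2 - ∑ i ∈ s, ‖⟪v i, x⟫_ℂ‖ ^ 2)
        (SummationFilter.unconditional ι).filter (𝓝 0) := by
      rw [← sub_self (‖x‖ ^ 2)]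
      exact Tendsto.const_sub (‖x‖ ^ 2) hx
    have h1 := h0.sqrt
    rw [Real.sqrt_zero] at h1
    refine h1.congr fun s => ?_
    rw [← key s, Real.sqrt_sq (norm_nonneg _), norm_sub_rev]
  have := (innerSL ℂ w).hasSum hS
  simpa [inner_smul_right, mul_comm] using this

/-- If `x ⊥ y`, no `v i` meets both `x` and `y`, and Bessel's inequality is an equality at
`x + y`, then it is an equality at `y`. -/
theorem hasSum_sq_inner_right_of_add (hv : Orthonormal ℂ v) (hxy : ⟪x, y⟫_ℂ = 0)
    (h : ∀ i, ⟪v i, x⟫_ℂ = 0 ∨ ⟪v i, y⟫_ℂ = 0)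
    (hs : HasSum (fun i => ‖⟪v i, x + y⟫_ℂ‖ ^ 2) (‖x + y‖ ^ 2)) :
    HasSum (fun i => ‖⟪v i, y⟫_ℂ‖ ^ 2) (‖y‖ ^ 2) := by
  have hx := hv.inner_products_summable (x := x)
  have hy := hv.inner_products_summable (x := y)
  have lx := hv.tsum_inner_products_le (x := x)
  have ly := hv.tsum_inner_products_le (x := y)
  have e1 : (fun i => ‖⟪v i, x + y⟫_ℂ‖ ^ 2)
      = fun i => ‖⟪v i, x⟫_ℂ‖ ^ 2 + ‖⟪v i, y⟫_ℂ‖ ^ 2 := by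
    ext i
    rw [inner_add_right]
    rcases h i with h | h <;> simp [h]
  have e2 : ‖x + y‖ ^ 2 = ‖x‖ ^ 2 + ‖y‖ ^ 2 := by
    rw [@norm_add_sq ℂ, hxy]; simp
  rw [e1, e2] at hs
  have := hs.unique (hx.hasSum.add hy.hasSum)
  -- The Bessel bounds for `x` and `y` add up to an equality, so neither is strict.
  have : ‖y‖ ^ 2 = ∑' i, ‖⟪v i, y⟫_ℂ‖ ^ 2 := by linarith
  rw [this]
  exact hy.hasSum

end Hilbert

/-! ### Uniqueness of Fourier coefficients on [0, 1) -/

/-- Finite measures on `[0, 1)` are determined by their Fourier coefficients. -/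
theorem ext_of_charFun_two_pi {α β : Measure ℝ} [IsFiniteMeasure α] [IsFiniteMeasure β]
    (hα : α (Set.Ico 0 1)ᶜ = 0) (hβ : β (Set.Ico 0 1)ᶜ = 0)
    (h : ∀ k : ℤ, charFun α (2 * Real.pi * k) = charFun β (2 * Real.pi * k)) : α = β := by
  -- On the circle trigonometric polynomials are dense in C; the section `r` below brings the
  -- measures back to [0, 1).
  let q : ℝ → UnitAddCircle := fun x => (x : UnitAddCircle)
  have hq : Measurable q := AddCircle.measurable_mk'
  have key : α.map q = β.map q := by
    have hint : ∀ F : C(UnitAddCircle, ℂ), ∫ z, F z ∂(α.map q) = ∫ z, F z ∂(β.map q) := by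
      let L : Measure ℝ → C(UnitAddCircle, ℂ) → ℂ := fun γ F => ∫ z, F z ∂(γ.map q)
      have hb : ∀ (γ : Measure ℝ) [IsFiniteMeasure γ] (F : C(UnitAddCircle, ℂ)),
          Integrable (fun z => F z) (γ.map q) := by
        intro γ _ F
        exact Integrable.of_bound F.continuous.aestronglyMeasurable ‖F‖
          (ae_of_all _ fun z => F.norm_coe_le_norm z)
      have hc : ∀ (γ : Measure ℝ) [IsFiniteMeasure γ], Continuous (L γ) := by
        intro γ _
        refine continuous_iff_continuousAt.2 fun F => ?_
        refine tendsto_integral_filter_of_dominated_convergence (fun _ => ‖F‖ + 1) ?_ ?_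
          (integrable_const _) ?_
        · exact Eventually.of_forall fun G => G.continuous.aestronglyMeasurable
        · filter_upwards [Metric.ball_mem_nhds F one_pos] with G hG
          refine ae_of_all _ fun z => (G.norm_coe_le_norm z).trans ?_
          have := norm_sub_norm_le G F
          rw [← dist_eq_norm] at this
          linarith [Metric.mem_ball.1 hG]
        · exact ae_of_all _ fun z => (continuous_eval_const z).tendsto F
      have hcl : IsClosed {F : C(UnitAddCircle, ℂ) | L α F = L β F} :=
        isClosed_eq (hc α) (hc β)
      have hspan : (Submodule.span ℂ (Set.range (@fourier 1)) : Set C(UnitAddCircle, ℂ))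
          ⊆ {F | L α F = L β F} := by
        intro F hF
        induction hF using Submodule.span_induction with
        | mem F hF =>
          obtain ⟨k, rfl⟩ := hF
          have : ∀ γ : Measure ℝ, L γ (fourier k) = charFun γ (2 * Real.pi * k) := by
            intro γ
            simp only [L]
            rw [integral_map hq.aemeasurable (fourier k).continuous.aestronglyMeasurable,
              charFun_apply_real]
            congr 1
            ext x
            simp only [q, fourier_coe_apply]
            congr 1
            push_cast
            ring
          simp only [Set.mem_ofPred_eq, this, h]
        | zero => simp [L]
        | add F G _ _ hF hG =>
          simp only [Set.mem_ofPred_eq, L, ContinuousMap.add_apply] at hF hG ⊢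
          rw [integral_add (hb α F) (hb α G), integral_add (hb β F) (hb β G), hF, hG]
        | smul c F _ hF =>
          simp only [Set.mem_ofPred_eq, L, ContinuousMap.smul_apply] at hF ⊢
          rw [integral_smul, integral_smul, hF]
      intro F
      have hF : F ∈ (Submodule.span ℂ (Set.range (@fourier 1))).topologicalClosure := by
        rw [span_fourier_closure_eq_top]; trivial
      exact closure_minimal hspan hcl hF
    refine ext_of_forall_integral_eq_of_IsFiniteMeasure fun F => ?_
    have := hint ⟨fun z => (F z : ℂ), by fun_prop⟩
    simp only [ContinuousMap.coe_mk] at this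
    rw [integral_complex_ofReal, integral_complex_ofReal] at this
    exact_mod_cast this
  let r : UnitAddCircle → ℝ := fun z => (AddCircle.measurableEquivIco 1 0 z : ℝ)
  have hr : Measurable r := by
    exact measurable_subtype_coe.comp (AddCircle.measurableEquivIco 1 0).measurable
  have hrq : ∀ γ : Measure ℝ, γ (Set.Ico 0 1)ᶜ = 0 → (γ.map q).map r = γ := by
    intro γ hγ
    rw [Measure.map_map hr hq]
    conv_rhs => rw [← Measure.map_id (μ := γ)]
    refine Measure.map_congr ?_
    have : ∀ᵐ x ∂γ, x ∈ Set.Ico (0 : ℝ) 1 := hγ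
    filter_upwards [this] with x hx
    have := AddCircle.coe_equivIco_mk_apply (1 : ℝ) x
    simp only [Function.comp, r, q, id]
    have h2 : (AddCircle.measurableEquivIco 1 0 (x : UnitAddCircle) : ℝ)
      = (AddCircle.equivIco 1 0 (x : UnitAddCircle) : ℝ) := rfl
    rw [h2, this]
    simp [Int.fract_eq_self.2 hx]
  rw [← hrq α hα, ← hrq β hβ, key]

/-! ### Fourier data of the uniform distribution -/

theorem unif_one : unif 1 = volume.restrict (Set.Icc (0 : ℝ) 1) := by
  simp [unif, ProbabilityTheory.cond]

instance : IsProbabilityMeasure (unif 1) :=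
  ProbabilityTheory.cond_isProbabilityMeasure_of_finite (by simp) (by simp)

theorem integral_unif_one {F : Type*} [NormedAddCommGroup F] [NormedSpace ℝ F] (φ : ℝ → F) :
    ∫ x, φ x ∂(unif 1) = ∫ x in (0 : ℝ)..1, φ x := by
  rw [unif_one, intervalIntegral.integral_of_le zero_le_one, integral_Icc_eq_integral_Ioc]

theorem unif_one_compl : unif 1 (Set.Ico 0 1)ᶜ = 0 := by
  rw [unif_one, Measure.restrict_apply measurableSet_Ico.compl]
  refine measure_mono_null (t := {1}) ?_ (by simp)
  rintro x ⟨h1, h2⟩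
  simp only [Set.mem_compl_iff, Set.mem_Ico, not_and, not_lt] at h1
  exact le_antisymm h2.2 (h1 h2.1)

theorem charFun_unif_one {k : ℤ} (hk : k ≠ 0) : charFun (unif 1) (2 * Real.pi * k) = 0 := by
  rw [charFun_apply_real, integral_unif_one]
  have hc : (2 * Real.pi * k * Complex.I : ℂ) ≠ 0 := by
    simp [hk, Real.pi_ne_zero]
  have : ∀ x : ℝ, Complex.exp (((2 * Real.pi * k : ℝ) : ℂ) * x * Complex.I)
      = Complex.exp ((2 * Real.pi * k * Complex.I : ℂ) * x) := by
    intro x; congr 1; push_cast; ring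
  simp_rw [this]
  rw [integral_exp_mul_complex hc]
  have : Complex.exp ((2 * Real.pi * k * Complex.I : ℂ) * (1 : ℝ)) = 1 := by
    rw [Complex.exp_eq_one_iff]
    exact ⟨k, by push_cast; ring⟩
  rw [this]
  simp

/-- `U * exp (-2πik U)` has mean `i / (2πk)` when `U` is uniform on `[0, 1]`. -/
theorem integral_unif_one_mul_exp {k : ℤ} (hk : k ≠ 0) (c : ℝ) :
    ∫ x, Complex.exp (-(2 * Real.pi * k * x * Complex.I)) * ((x : ℂ) - c) ∂(unif 1)
      = Complex.I / (2 * Real.pi * k) := by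
  rw [integral_unif_one]
  have hc : (-(2 * Real.pi * k * Complex.I) : ℂ) ≠ 0 := by
    simp [hk, Real.pi_ne_zero]
  set a : ℂ := -(2 * Real.pi * k * Complex.I) with ha
  -- Integration by parts; as exp a = 1, the constant `c` cancels between the endpoints.
  have hd : ∀ x ∈ Set.uIcc (0 : ℝ) 1, HasDerivAt
      (fun x : ℝ => Complex.exp (a * x) * (((x : ℂ) - c) / a - 1 / a ^ 2))
      (Complex.exp (a * x) * ((x : ℂ) - c)) x := by
    intro x _
    have h1 : HasDerivAt (fun x : ℝ => (x : ℂ)) 1 x := Complex.ofRealCLM.hasDerivAt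
    have h2 : HasDerivAt (fun x : ℝ => Complex.exp (a * x)) (Complex.exp (a * x) * (a * 1)) x :=
      (h1.const_mul a).cexp
    have h3 : HasDerivAt (fun x : ℝ => ((x : ℂ) - c) / a - 1 / a ^ 2) (1 / a) x :=
      ((h1.sub_const _).div_const a).sub_const _
    convert! h2.mul h3 using 1
    field_simp
    ring
  have := intervalIntegral.integral_eq_sub_of_hasDerivAt hd
    (by apply Continuous.intervalIntegrable; fun_prop)
  have he : ∀ x : ℝ, Complex.exp (-(2 * Real.pi * k * x * Complex.I)) * ((x : ℂ) - c)
      = Complex.exp (a * x) * ((x : ℂ) - c) := by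
    intro x; rw [ha]; congr 2; ring
  simp_rw [he]
  rw [this]
  have h1 : Complex.exp (a * (1 : ℝ)) = 1 := by
    rw [Complex.exp_eq_one_iff]
    exact ⟨-k, by rw [ha]; push_cast; ring⟩
  rw [h1]
  simp only [Complex.ofReal_zero, mul_zero, Complex.exp_zero, Complex.ofReal_one]
  have : (1 : ℂ) * ((1 - c) / a - 1 / a ^ 2) - 1 * ((0 - c) / a - 1 / a ^ 2) = 1 / a := by ring
  rw [this, ha]
  have hk' : (k : ℂ) ≠ 0 := by exact_mod_cast hk
  have hp : (Real.pi : ℂ) ≠ 0 := by exact_mod_cast Real.pi_ne_zero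
  field_simp
  simp

/-! ### Factor pairs and characters -/

/-- Probability measures `μ`, `ν` on `[0, ∞)` with `μ ∗ ν = 𝓛_{[0,1]}`. -/
structure IsFactorPair (μ ν : Measure ℝ) : Prop where
  left_prob : IsProbabilityMeasure μ
  right_prob : IsProbabilityMeasure ν
  left_nonneg : μ (Set.Iio 0) = 0
  right_nonneg : ν (Set.Iio 0) = 0
  conv_eq : μ.conv ν = unif 1

theorem IsFactorPair.symm {μ ν : Measure ℝ} (h : IsFactorPair μ ν) : IsFactorPair ν μ := by
  have := h.left_prob
  have := h.right_prob
  exact ⟨h.right_prob, h.left_prob, h.right_nonneg, h.left_nonneg,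
    (Measure.conv_comm ν μ).trans h.conv_eq⟩

theorem conv_apply_eq (μ ν : Measure ℝ) {S : Set ℝ} (hS : MeasurableSet S) :
    μ.conv ν S = μ.prod ν ((fun p : ℝ × ℝ => p.1 + p.2) ⁻¹' S) := by
  rw [Measure.conv, Measure.map_apply (by fun_prop) hS]

/-- Adding a nonnegative variable cannot bring mass back below 1, and the uniform law has none on
[1, ∞). Excluding the endpoint 1 makes [0, 1) embed in the circle. -/
theorem IsFactorPair.left_compl {μ ν : Measure ℝ} (h : IsFactorPair μ ν) :
    μ (Set.Ico 0 1)ᶜ = 0 := by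
  have := h.left_prob
  have := h.right_prob
  have hν : ν (Set.Ici 0) = 1 := by
    rw [← Set.compl_Iio, prob_compl_eq_one_iff measurableSet_Iio]
    exact h.right_nonneg
  have h1 : μ (Set.Ici 1) = 0 := by
    have h2 : (μ.prod ν) (Set.Ici 1 ×ˢ Set.Ici 0) ≤ μ.conv ν (Set.Ici 1) := by
      rw [conv_apply_eq μ ν measurableSet_Ici]
      refine measure_mono ?_
      rintro ⟨x, y⟩ ⟨hx, hy⟩
      simp only [Set.mem_Ici, Set.mem_preimage] at *
      linarith
    rw [Measure.prod_prod, hν, mul_one, h.conv_eq] at h2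
    refine le_antisymm (h2.trans ((measure_mono ?_).trans_eq unif_one_compl)) (zero_le)
    intro x hx hx'
    exact absurd hx'.2 (not_lt.2 hx)
  have : (Set.Ico (0 : ℝ) 1)ᶜ ⊆ Set.Iio 0 ∪ Set.Ici 1 := by
    intro x hx
    simp only [Set.mem_compl_iff, Set.mem_Ico, not_and, not_lt] at hx
    by_cases h0 : x < 0
    · exact Or.inl h0
    · exact Or.inr (hx (not_lt.1 h0))
  exact measure_mono_null this (measure_union_null h.left_nonneg h1)

theorem IsFactorPair.charFun_mul_eq_zero {μ ν : Measure ℝ} (h : IsFactorPair μ ν) {k : ℤ}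
    (hk : k ≠ 0) :
    charFun μ (2 * Real.pi * k) = 0 ∨ charFun ν (2 * Real.pi * k) = 0 := by
  have := h.left_prob
  have := h.right_prob
  rw [← mul_eq_zero, ← charFun_conv, h.conv_eq, charFun_unif_one hk]

/-- The character `x ↦ exp (2πikx)`. -/
noncomputable def chi (k : ℤ) (x : ℝ) : ℂ := Complex.exp (2 * Real.pi * k * x * Complex.I)

theorem measurable_chi (k : ℤ) : Measurable (chi k) := by unfold chi; fun_prop

theorem norm_chi (k : ℤ) (x : ℝ) : ‖chi k x‖ = 1 := by
  unfold chi
  rw [Complex.norm_exp]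
  simp

theorem conj_chi (k : ℤ) (x : ℝ) : conj (chi k x) = chi (-k) x := by
  unfold chi
  rw [← Complex.exp_conj]
  congr 1
  simp [Complex.conj_ofNat]

theorem chi_add (j k : ℤ) (x : ℝ) : chi (j + k) x = chi j x * chi k x := by
  unfold chi
  rw [← Complex.exp_add]
  congr 1
  push_cast
  ring

theorem chi_add_right (k : ℤ) (x y : ℝ) : chi k (x + y) = chi k x * chi k y := by
  unfold chi
  rw [← Complex.exp_add]
  congr 1
  push_cast
  ring

theorem chi_zero (x : ℝ) : chi 0 x = 1 := by simp [chi]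

theorem integral_chi (μ : Measure ℝ) (k : ℤ) :
    ∫ x, chi k x ∂μ = charFun μ (2 * Real.pi * k) := by
  rw [charFun_apply_real]
  simp [chi]

theorem charFun_two_pi_neg (μ : Measure ℝ) (k : ℤ) :
    charFun μ (2 * Real.pi * (-k : ℤ)) = conj (charFun μ (2 * Real.pi * k)) := by
  rw [← charFun_neg]
  congr 1
  push_cast
  ring

theorem charFun_two_pi_neg_eq_zero (μ : Measure ℝ) (k : ℤ) :
    charFun μ (2 * Real.pi * (-k : ℤ)) = 0 ↔ charFun μ (2 * Real.pi * k) = 0 := by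
  rw [charFun_two_pi_neg, map_eq_zero]

theorem inner_toLp_toLp {Ω : Type*} [MeasurableSpace Ω] {m : Measure Ω} {f g : Ω → ℂ}
    (hf : MemLp f 2 m) (hg : MemLp g 2 m) :
    ⟪hf.toLp f, hg.toLp g⟫_ℂ = ∫ a, conj (f a) * g a ∂m := by
  rw [L2.inner_def]
  refine integral_congr_ae ?_
  filter_upwards [hf.coeFn_toLp, hg.coeFn_toLp] with a h1 h2
  rw [h1, h2, RCLike.inner_apply, mul_comm]

/-- The value equals the variance of the uniform law, so Bessel's equality for it follows from ζ(2).
The term k = 0 is 0 because division by zero gives 0. -/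
theorem hasSum_sq_coeff :
    HasSum (fun k : ℤ => ‖Complex.I / (2 * Real.pi * k)‖ ^ 2) (1 / 12) := by
  have h0 : ∀ k : ℤ, ‖Complex.I / (2 * Real.pi * k)‖ ^ 2
      = 1 / (4 * Real.pi ^ 2) * (1 / (k : ℝ) ^ 2) := by
    intro k
    rw [norm_div, norm_mul, norm_mul, Complex.norm_I, Complex.norm_ofNat, Complex.norm_real,
      Complex.norm_intCast, Real.norm_eq_abs, div_pow, mul_pow, mul_pow, sq_abs, sq_abs,
      div_mul_div_comm]
    norm_num
  simp_rw [h0]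
  have hp : (Real.pi : ℝ) ≠ 0 := Real.pi_ne_zero
  have h1 : HasSum (fun n : ℕ => (1 : ℝ) / (((n : ℤ) : ℝ)) ^ 2) (Real.pi ^ 2 / 6) := by
    simpa only [Int.cast_natCast] using hasSum_zeta_two
  have h2 : HasSum (fun n : ℕ => (1 : ℝ) / (((-(n : ℤ) : ℤ) : ℝ)) ^ 2) (Real.pi ^ 2 / 6) := by
    simpa only [Int.cast_neg, Int.cast_natCast, neg_sq] using hasSum_zeta_two
  have h3 := (HasSum.of_nat_of_neg (f := fun k : ℤ => (1 : ℝ) / (k : ℝ) ^ 2) h1 h2).mul_left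
    (1 / (4 * Real.pi ^ 2))
  have h4 : 1 / (4 * Real.pi ^ 2) * (Real.pi ^ 2 / 6 + Real.pi ^ 2 / 6 - 1 / ((0 : ℤ) : ℝ) ^ 2)
      = 1 / 12 := by
    simp only [Int.cast_zero, ne_eq, OfNat.ofNat_ne_zero, not_false_eq_true, zero_pow, div_zero,
      sub_zero]
    field_simp
    norm_num
  rw [h4] at h3
  exact h3

theorem integral_unif_one_id : ∫ x, x ∂(unif 1) = 1 / 2 := by
  rw [integral_unif_one]; simp

theorem integral_unif_one_sq : ∫ x, (x - 1 / 2) ^ 2 ∂(unif 1) = 1 / 12 := by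
  rw [integral_unif_one, intervalIntegral.integral_comp_sub_right (fun x => x ^ 2),
    integral_pow]
  norm_num

/-! ### Parseval's identity for one summand -/

/-- The `k`-th Fourier coefficient of the second factor as a function of the uniform sum. -/
noncomputable def fiberCoeff (μ : Measure ℝ) (k : ℤ) : ℂ :=
  open Classical in
  -- At k = 0 the second branch applies and gives I / 0 = 0, the correct mean of a centred variable.
  if charFun μ (2 * Real.pi * k) = 0 then 0 else Complex.I / (2 * Real.pi * k)

theorem integrable_of_compl {μ : Measure ℝ} [IsFiniteMeasure μ] (hμ : μ (Set.Ico 0 1)ᶜ = 0) :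
    Integrable (fun x : ℝ => x) μ := by
  refine Integrable.of_bound measurable_id.aestronglyMeasurable 1 ?_
  have : ∀ᵐ x ∂μ, x ∈ Set.Ico (0 : ℝ) 1 := hμ
  filter_upwards [this] with x hx
  rw [Real.norm_eq_abs, abs_of_nonneg hx.1]
  exact hx.2.le

/-- Parseval's identity for the second factor, centred, as a function of the uniform sum. -/
theorem IsFactorPair.hasSum_fiberCoeff {μ ν : Measure ℝ} (h : IsFactorPair μ ν) (k : ℤ) :
    HasSum (fun j : ℤ => conj (fiberCoeff μ (j - k)) * fiberCoeff μ j)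
      (conj (charFun μ (2 * Real.pi * k)) *
        ∫ y, chi (-k) y * ((y : ℂ) - (∫ z, z ∂ν : ℝ)) ^ 2 ∂ν) := by
  have := h.left_prob
  have := h.right_prob
  set a : ℝ := ∫ z, z ∂μ with ha
  set b : ℝ := ∫ z, z ∂ν with hb
  let m := μ.prod ν
  have hx01 : ∀ᵐ p ∂m, p.1 ∈ Set.Ico (0 : ℝ) 1 :=
    Measure.quasiMeasurePreserving_fst.ae (show ∀ᵐ x ∂μ, x ∈ Set.Ico (0 : ℝ) 1 from h.left_compl)
  have hy01 : ∀ᵐ p ∂m, p.2 ∈ Set.Ico (0 : ℝ) 1 :=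
    Measure.quasiMeasurePreserving_snd.ae
      (show ∀ᵐ x ∂ν, x ∈ Set.Ico (0 : ℝ) 1 from h.symm.left_compl)
  -- `E j` is a character of the sum of the coordinates, and `X + Y` is that sum minus its mean 1/2.
  let E : ℤ → ℝ × ℝ → ℂ := fun j p => chi j p.1 * chi j p.2
  let X : ℝ × ℝ → ℂ := fun p => (p.1 : ℂ) - a
  let Y : ℝ × ℝ → ℂ := fun p => (p.2 : ℂ) - b
  have hEm : ∀ j, Measurable (E j) := fun j =>
    ((measurable_chi j).comp measurable_fst).mul ((measurable_chi j).comp measurable_snd)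
  have hXm : Measurable X := by fun_prop
  have hYm : Measurable Y := by fun_prop
  have hEn : ∀ j p, ‖E j p‖ = 1 := fun j p => by simp [E, norm_chi]
  have hbd : ∀ (t c : ℝ), t ∈ Set.Ico (0 : ℝ) 1 → ‖(t : ℂ) - c‖ ≤ 1 + |c| := by
    intro t c ht
    refine (norm_sub_le _ _).trans ?_
    simp only [Complex.norm_real, Real.norm_eq_abs]
    rw [abs_of_nonneg ht.1]
    linarith [ht.2]
  have hE : ∀ j, MemLp (E j) 2 m := fun j =>
    MemLp.of_bound (hEm j).aestronglyMeasurable 1 (ae_of_all _ fun p => (hEn j p).le)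
  have hX : MemLp X 2 m := MemLp.of_bound hXm.aestronglyMeasurable (1 + |a|) (by
    filter_upwards [hx01] with p hp using hbd _ _ hp)
  have hY : MemLp Y 2 m := MemLp.of_bound hYm.aestronglyMeasurable (1 + |b|) (by
    filter_upwards [hy01] with p hp using hbd _ _ hp)
  -- Multiplying `Y` by `E k` shifts its coefficients by `k`, so pairing with `Y` gives their
  -- autocorrelation.
  have hW : MemLp (fun p => Y p * E k p) 2 m :=
    MemLp.of_bound (hYm.mul (hEm k)).aestronglyMeasurable (1 + |b|) (by
      filter_upwards [hy01] with p hp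
      rw [norm_mul, hEn, mul_one]
      exact hbd _ _ hp)
  have hXi : Integrable (fun x : ℝ => (x : ℂ)) μ := (integrable_of_compl h.left_compl).ofReal
  have hYi : Integrable (fun x : ℝ => (x : ℂ)) ν :=
    (integrable_of_compl h.symm.left_compl).ofReal
  have hX0 : ∫ x, ((x : ℂ) - a) ∂μ = 0 := by
    rw [integral_sub hXi (integrable_const _), integral_complex_ofReal]
    simp [ha]
  have hY0 : ∫ x, ((x : ℂ) - b) ∂ν = 0 := by
    rw [integral_sub hYi (integrable_const _), integral_complex_ofReal]
    simp [hb]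
  have hmap : ∀ φ : ℝ → ℂ, Measurable φ → ∫ p, φ (p.1 + p.2) ∂m = ∫ u, φ u ∂(unif 1) := by
    intro φ hφ
    rw [← h.conv_eq, Measure.conv, integral_map (by fun_prop) hφ.aestronglyMeasurable]
  have hab : a + b = 1 / 2 := by
    have h1 := hmap (fun u => (u : ℂ)) (by fun_prop)
    rw [integral_complex_ofReal (μ := unif 1), integral_unif_one_id] at h1
    have h2 : ∫ p : ℝ × ℝ, ((p.1 + p.2 : ℝ) : ℂ) ∂m = a + b := by
      push_cast
      rw [integral_add (hXi.comp_fst ν) (hYi.comp_snd μ)]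
      rw [integral_fun_fst (fun x : ℝ => (x : ℂ)), integral_fun_snd (fun x : ℝ => (x : ℂ)),
        integral_complex_ofReal, integral_complex_ofReal]
      simp [ha, hb]
    rw [h2] at h1
    exact_mod_cast h1
  have hEE : ∀ i j, ⟪(hE i).toLp, (hE j).toLp⟫_ℂ = if i = j then 1 else 0 := by
    intro i j
    rw [inner_toLp_toLp]
    have : ∀ p : ℝ × ℝ, conj (E i p) * E j p = chi (j - i) p.1 * chi (j - i) p.2 := by
      intro p
      simp only [E, map_mul, conj_chi]
      rw [sub_eq_neg_add, chi_add, chi_add]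
      ring
    simp_rw [this]
    rw [integral_prod_mul (chi (j - i)) (chi (j - i)), integral_chi, integral_chi]
    split_ifs with hij
    · simp [hij]
    · exact mul_eq_zero.2 (h.charFun_mul_eq_zero (sub_ne_zero.2 (Ne.symm hij)))
  have hortho : Orthonormal ℂ (fun j => (hE j).toLp) := orthonormal_iff_ite.2 hEE
  have hEX : ∀ j, ⟪(hE j).toLp, hX.toLp⟫_ℂ
      = (∫ x, chi (-j) x * ((x : ℂ) - a) ∂μ) * charFun ν (2 * Real.pi * (-j : ℤ)) := by
    intro j
    rw [inner_toLp_toLp, ← integral_chi,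
      ← integral_prod_mul (fun x : ℝ => chi (-j) x * ((x : ℂ) - a)) (chi (-j))]
    refine integral_congr_ae (ae_of_all _ fun p => ?_)
    simp only [E, X, map_mul, conj_chi]
    ring
  have hEY : ∀ j, ⟪(hE j).toLp, hY.toLp⟫_ℂ
      = charFun μ (2 * Real.pi * (-j : ℤ)) * ∫ x, chi (-j) x * ((x : ℂ) - b) ∂ν := by
    intro j
    rw [inner_toLp_toLp, ← integral_chi,
      ← integral_prod_mul (chi (-j)) (fun x : ℝ => chi (-j) x * ((x : ℂ) - b))]
    refine integral_congr_ae (ae_of_all _ fun p => ?_)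
    simp only [E, Y, map_mul, conj_chi]
    ring
  have hsum : ∀ j, ⟪(hE j).toLp, hX.toLp + hY.toLp⟫_ℂ = Complex.I / (2 * Real.pi * j) := by
    intro j
    by_cases hj : j = 0
    · rw [inner_add_right, hEX, hEY, hj]
      simp only [neg_zero, chi_zero, one_mul, hX0, hY0]
      simp
    · rw [← MemLp.toLp_add, inner_toLp_toLp, ← integral_unif_one_mul_exp hj (a + b),
        ← hmap _ (by fun_prop)]
      refine integral_congr_ae (ae_of_all _ fun p => ?_)
      simp only [E, X, Y, Pi.add_apply, ← chi_add_right, conj_chi]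
      simp only [chi]
      push_cast
      congr 1
      · congr 1
        ring
      · ring
  have hnorm : ‖hX.toLp + hY.toLp‖ ^ 2 = 1 / 12 := by
    have h1 : ⟪hX.toLp + hY.toLp, hX.toLp + hY.toLp⟫_ℂ = ((1 / 12 : ℝ) : ℂ) := by
      rw [← MemLp.toLp_add, inner_toLp_toLp, ← integral_unif_one_sq, ← integral_complex_ofReal,
        ← hmap (fun u => (((u - 1 / 2) ^ 2 : ℝ) : ℂ)) (by fun_prop)]
      refine integral_congr_ae (ae_of_all _ fun p => ?_)
      simp only [X, Y, Pi.add_apply, ← hab]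
      push_cast
      simp only [map_add, map_sub, Complex.conj_ofReal]
      ring
    rw [inner_self_eq_norm_sq_to_K] at h1
    exact Complex.ofReal_injective (by push_cast at h1 ⊢; exact h1)
  have hXY : ⟪hX.toLp, hY.toLp⟫_ℂ = 0 := by
    rw [inner_toLp_toLp]
    have : ∀ p : ℝ × ℝ, conj (X p) * Y p = ((p.1 : ℂ) - a) * ((p.2 : ℂ) - b) := by
      intro p; simp [X, Y]
    simp_rw [this]
    rw [integral_prod_mul (fun x : ℝ => (x : ℂ) - a) (fun x : ℝ => (x : ℂ) - b), hX0, zero_mul]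
  -- The coefficient of `X` carries a factor ν̂(-j), that of `Y` a factor μ̂(-j). At j = 0 centring
  -- replaces this argument.
  have hzero : ∀ j, ⟪(hE j).toLp, hX.toLp⟫_ℂ = 0 ∨ ⟪(hE j).toLp, hY.toLp⟫_ℂ = 0 := by
    intro j
    by_cases hj : j = 0
    · left
      rw [hEX, hj]
      simp [chi_zero, hX0]
    · rcases h.charFun_mul_eq_zero (neg_ne_zero.2 hj) with h0 | h0
      · right
        rw [hEY, h0, zero_mul]
      · left
        rw [hEX, h0, mul_zero]
  -- Where μ̂(j) ≠ 0 and j ≠ 0, ν̂(j) = 0 removes the contribution of `X`, and `Y` takes the whole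
  -- coefficient of the uniform variable.
  have hcoef : ∀ j, ⟪(hE j).toLp, hY.toLp⟫_ℂ = fiberCoeff μ j := by
    intro j
    unfold fiberCoeff
    split_ifs with hj
    · rw [hEY, (charFun_two_pi_neg_eq_zero μ j).2 hj, zero_mul]
    · by_cases hj0 : j = 0
      · rw [hEY, hj0]
        simp [chi_zero, hY0]
      · rw [← hsum, inner_add_right, hEX, (charFun_two_pi_neg_eq_zero ν j).2
          ((h.charFun_mul_eq_zero hj0).resolve_left hj), mul_zero, zero_add]
  have hbessel := hasSum_sq_inner_right_of_add hortho hXY hzero (by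
    rw [hnorm]; simp_rw [hsum]; exact hasSum_sq_coeff)
  have hpars := hasSum_inner_mul_inner_of_hasSum_sq hortho hbessel hW.toLp
  have hWE : ∀ j, ⟪hW.toLp, (hE j).toLp⟫_ℂ = conj (fiberCoeff μ (j - k)) := by
    intro j
    rw [← hcoef, inner_conj_symm, inner_toLp_toLp, inner_toLp_toLp]
    refine integral_congr_ae (ae_of_all _ fun p => ?_)
    simp only [E, map_mul, conj_chi]
    rw [sub_eq_neg_add, chi_add, chi_add]
    ring
  have hWY : ⟪hW.toLp, hY.toLp⟫_ℂ = conj (charFun μ (2 * Real.pi * k)) *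
        ∫ y, chi (-k) y * ((y : ℂ) - b) ^ 2 ∂ν := by
    rw [inner_toLp_toLp, ← charFun_two_pi_neg, ← integral_chi,
      ← integral_prod_mul (chi (-k)) (fun y : ℝ => chi (-k) y * ((y : ℂ) - b) ^ 2)]
    refine integral_congr_ae (ae_of_all _ fun p => ?_)
    simp only [E, Y, map_mul, map_sub, Complex.conj_ofReal, conj_chi]
    ring
  rw [hWY] at hpars
  simp_rw [hWE, hcoef] at hpars
  exact hpars

/-! ### The support of the Fourier coefficients -/

theorem conj_fiberCoeff_mul {μ : Measure ℝ} {i j : ℤ} (hi : charFun μ (2 * Real.pi * i) ≠ 0)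
    (hj : charFun μ (2 * Real.pi * j) ≠ 0) :
    conj (fiberCoeff μ i) * fiberCoeff μ j
      = ((1 / (4 * Real.pi ^ 2) * (1 / ((i : ℝ) * j)) : ℝ) : ℂ) := by
  rw [fiberCoeff, fiberCoeff, if_neg hi, if_neg hj]
  push_cast
  simp only [map_div₀, map_mul, Complex.conj_I, Complex.conj_ofReal, Complex.conj_ofNat,
    map_intCast]
  rw [div_mul_div_comm, neg_mul, Complex.I_mul_I, neg_neg, div_mul_div_comm]
  congr 1
  · ring
  · ring

/-- The nonzero Fourier coefficients of the first factor sit at multiples of the least one. -/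
theorem IsFactorPair.dvd_of_charFun_ne_zero {μ ν : Measure ℝ} (h : IsFactorPair μ ν) {N : ℕ}
    (hN : 0 < N) (hne : charFun μ (2 * Real.pi * (N : ℤ)) ≠ 0)
    (hmin : ∀ k : ℕ, 0 < k → k < N → charFun μ (2 * Real.pi * (k : ℤ)) = 0) {k : ℤ}
    (hk : charFun μ (2 * Real.pi * k) ≠ 0) : (N : ℤ) ∣ k := by
  have hneg : ∀ k : ℤ, charFun μ (2 * Real.pi * (-k : ℤ)) ≠ 0 ↔ charFun μ (2 * Real.pi * k) ≠ 0 :=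
    fun k => not_congr (charFun_two_pi_neg_eq_zero μ k)
  have main : ∀ n : ℕ, charFun μ (2 * Real.pi * (n : ℤ)) ≠ 0 → N ∣ n := by
    intro n
    induction n using Nat.strong_induction_on with
    | _ n ih =>
    intro hn
    by_contra hdvd
    have hlt : N < n := by
      rcases lt_trichotomy n N with h1 | h1 | h1
      · rcases Nat.eq_zero_or_pos n with h0 | h0
        · exact absurd (h0 ▸ dvd_zero N) hdvd
        · exact absurd (hmin n h0 h1) hn
      · exact absurd (h1 ▸ dvd_rfl) hdvd
      · exact h1
    have ihz : ∀ i : ℤ, 0 < i → i < n → charFun μ (2 * Real.pi * i) ≠ 0 → (N : ℤ) ∣ i := by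
      intro i h0 h1 h2
      lift i to ℕ using h0.le
      exact Int.natCast_dvd_natCast.2 (ih i (by exact_mod_cast h1) h2)
    -- Chosen so that the term j = n of the autocorrelation pairs the frequencies n and N, both in
    -- the support.
    set k : ℤ := n - N with hkdef
    have hk0 : 0 < k := by omega
    have hNk : ¬ (N : ℤ) ∣ k := by
      intro hd
      apply hdvd
      rw [← Int.natCast_dvd_natCast]
      have := dvd_add hd (dvd_refl (N : ℤ))
      rwa [hkdef, sub_add_cancel] at this
    have hcf : charFun μ (2 * Real.pi * k) = 0 := by
      by_contra hc
      exact hNk (ihz k hk0 (by omega) hc)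
    have hs := h.hasSum_fiberCoeff k
    rw [hcf, map_zero, zero_mul] at hs
    have hre := Complex.hasSum_re hs
    rw [Complex.zero_re] at hre
    have hnonneg : ∀ j : ℤ, 0 ≤ (conj (fiberCoeff μ (j - k)) * fiberCoeff μ j).re := by
      intro j
      by_cases h1 : charFun μ (2 * Real.pi * (j - k : ℤ)) = 0
      · rw [fiberCoeff, if_pos h1, map_zero, zero_mul, Complex.zero_re]
      by_cases h2 : charFun μ (2 * Real.pi * j) = 0
      · rw [fiberCoeff.eq_1 μ j, if_pos h2, mul_zero, Complex.zero_re]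
      rw [conj_fiberCoeff_mul h1 h2, Complex.ofReal_re]
      -- A negative term needs 0 < j < k. Then j and k - j lie in the support below n, so N divides
      -- both and hence k, which is excluded.
      have hprod : 0 ≤ (j - k) * j := by
        by_contra hlt0
        have hj : 0 < j ∧ j < k := by
          constructor <;> by_contra hc <;> exact hlt0 (by nlinarith)
        have d1 := ihz j hj.1 (by omega) h2
        have d2 := ihz (k - j) (by omega) (by omega) (by
          rw [← hneg, neg_sub]; exact h1)
        exact hNk (by simpa using dvd_add d1 d2)
      have : (0 : ℝ) ≤ ((j - k : ℤ) : ℝ) * j := by exact_mod_cast hprod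
      positivity
    have hzero := (hasSum_zero_iff_of_nonneg hnonneg).1 hre
    -- The nonnegative terms sum to 0, yet the one at j = n is a positive multiple of 1/(Nn).
    have := congrFun hzero (n : ℤ)
    have hnk : ((n : ℤ) - k) = N := by omega
    simp only [hnk, Pi.zero_apply] at this
    rw [conj_fiberCoeff_mul hne hn, Complex.ofReal_re] at this
    have hn0 : 0 < n := by omega
    have : (0 : ℝ) < 1 / (4 * Real.pi ^ 2) * (1 / (((N : ℤ) : ℝ) * ((n : ℤ) : ℝ))) := by
      have : (0 : ℝ) < Real.pi := Real.pi_pos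
      have : (0 : ℝ) < ((N : ℤ) : ℝ) := by exact_mod_cast hN
      have : (0 : ℝ) < ((n : ℤ) : ℝ) := by exact_mod_cast hn0
      positivity
    linarith
  rcases Int.natAbs_eq k with h1 | h1
  · rw [h1] at hk ⊢
    exact Int.natCast_dvd_natCast.2 (main _ hk)
  · rw [h1] at hk ⊢
    rw [hneg] at hk
    exact (dvd_neg).2 (Int.natCast_dvd_natCast.2 (main _ hk))

/-! ### Degenerate factors -/

/-- A first factor with no nontrivial Fourier coefficient is the uniform distribution. -/
theorem IsFactorPair.eq_unif_of_charFun {μ ν : Measure ℝ} (h : IsFactorPair μ ν)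
    (h0 : ∀ k : ℤ, k ≠ 0 → charFun μ (2 * Real.pi * k) = 0) : μ = unif 1 := by
  have := h.left_prob
  refine ext_of_charFun_two_pi h.left_compl unif_one_compl fun k => ?_
  by_cases hk : k = 0
  · simp [hk]
  · rw [h0 k hk, charFun_unif_one hk]

/-- All coefficients of the centred second summand vanish, so Parseval at k = 0 says that `ν` has
variance 0. It is a point mass, and a translate of the uniform law equals it only for translation 0.
-/
theorem IsFactorPair.eq_dirac_of_eq_unif {ν : Measure ℝ} (h : IsFactorPair (unif 1) ν) :
    ν = Measure.dirac 0 := by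
  have := h.right_prob
  have hsum := h.hasSum_fiberCoeff 0
  have hd : ∀ j, fiberCoeff (unif 1) j = 0 := by
    intro j
    by_cases hj : j = 0
    · simp [fiberCoeff, hj]
    · rw [fiberCoeff, if_pos (charFun_unif_one hj)]
  simp_rw [hd] at hsum
  set b := ∫ z, z ∂ν
  have hz := hsum.unique (a₂ := 0) (by simp)
  have hν : ∀ᵐ x ∂ν, x ∈ Set.Ico (0 : ℝ) 1 := h.symm.left_compl
  have hI : ∫ y, (y - b) ^ 2 ∂ν = 0 := by
    have : ∫ y, ((((y - b) ^ 2 : ℝ)) : ℂ) ∂ν = 0 := by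
      simpa [chi_zero] using hz
    rw [integral_complex_ofReal] at this
    exact_mod_cast this
  have hint : Integrable (fun y => (y - b) ^ 2) ν := by
    refine Integrable.of_bound (by fun_prop) ((1 + |b|) ^ 2) ?_
    filter_upwards [hν] with y hy
    rw [Real.norm_eq_abs, abs_pow]
    gcongr
    refine (abs_sub _ _).trans ?_
    rw [abs_of_nonneg hy.1]
    linarith [hy.2]
  have hae : ∀ᵐ y ∂ν, y = b := by
    have := (integral_eq_zero_iff_of_nonneg (fun y => sq_nonneg (y - b)) hint).1 hI
    filter_upwards [this] with y hy
    exact sub_eq_zero.1 (pow_eq_zero_iff two_ne_zero |>.1 hy)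
  have hdir : ν = Measure.dirac b := by
    calc ν = ν.map id := Measure.map_id.symm
      _ = ν.map (fun _ => b) := Measure.map_congr hae
      _ = Measure.dirac b := by rw [Measure.map_const, measure_univ, one_smul]
  have hb : 0 ≤ b ∧ b < 1 := by
    obtain ⟨y, hy, hy'⟩ := (hae.and hν).exists
    exact hy ▸ hy'
  have hc := h.conv_eq
  rw [hdir, Measure.conv_dirac] at hc
  have h1 := congrArg (fun m => m (Set.Iio b)) hc
  beta_reduce at h1
  rw [Measure.map_apply (by fun_prop) measurableSet_Iio] at h1
  have h2 : (fun x : ℝ => x + b) ⁻¹' Set.Iio b = Set.Iio 0 := by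
    ext x; simp
  rw [h2, h.left_nonneg, unif_one, Measure.restrict_apply measurableSet_Iio] at h1
  have h3 : Set.Iio b ∩ Set.Icc 0 1 = Set.Ico 0 b := by
    ext x
    simp only [Set.mem_inter_iff, Set.mem_Iio, Set.mem_Icc, Set.mem_Ico]
    constructor
    · rintro ⟨h1, h2, h3⟩; exact ⟨h2, h1⟩
    · rintro ⟨h1, h2⟩; exact ⟨h2, h1, by linarith⟩
  rw [h3, Real.volume_Ico, sub_zero] at h1
  have : b ≤ 0 := ENNReal.ofReal_eq_zero.1 h1.symm
  rw [hdir, le_antisymm this hb.1]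

theorem IsFactorPair.eq_unif_of_eq_dirac {μ : Measure ℝ}
    (h : IsFactorPair μ (Measure.dirac 0)) : μ = unif 1 := by
  have := h.left_prob
  rw [← h.conv_eq, Measure.conv_dirac_zero]

/-! ### Grid measures -/

/-- The uniform distribution on `{0, 1/N, …, (N-1)/N}`. -/
noncomputable def grid (N : ℕ) : Measure ℝ :=
  (N : ℝ≥0∞)⁻¹ • ∑ j ∈ Finset.range N, Measure.dirac ((j : ℝ) / N)

theorem isProbabilityMeasure_smul_sum_dirac {N : ℕ} (hN : N ≠ 0) (x : ℕ → ℝ) :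
    IsProbabilityMeasure ((N : ℝ≥0∞)⁻¹ • ∑ j ∈ Finset.range N, Measure.dirac (x j)) := by
  constructor
  simp only [Measure.smul_apply, Measure.coe_finsetSum, Finset.sum_apply, measure_univ,
    Finset.sum_const, Finset.card_range, nsmul_eq_mul, mul_one, smul_eq_mul]
  exact ENNReal.inv_mul_cancel (by exact_mod_cast hN) (ENNReal.natCast_ne_top N)

theorem isProbabilityMeasure_grid {N : ℕ} (hN : N ≠ 0) : IsProbabilityMeasure (grid N) :=
  isProbabilityMeasure_smul_sum_dirac hN _

theorem grid_apply (N : ℕ) {S : Set ℝ} (hS : MeasurableSet S) :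
    grid N S = (N : ℝ≥0∞)⁻¹ * ∑ j ∈ Finset.range N, S.indicator 1 ((j : ℝ) / N) := by
  simp [grid, Measure.dirac_apply' _ hS]

theorem charFun_grid (N : ℕ) (t : ℝ) :
    charFun (grid N) t
      = (N : ℂ)⁻¹ * ∑ j ∈ Finset.range N, Complex.exp (t * ((j : ℝ) / N : ℝ) * Complex.I) := by
  rw [charFun_apply_real, grid, integral_smul_measure, integral_finsetSum_measure]
  · simp only [integral_dirac, ENNReal.toReal_inv, ENNReal.toReal_natCast, Complex.real_smul]
    push_cast
    rfl
  · intro j _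
    exact integrable_dirac (by simp)

theorem charFun_grid_of_dvd {N : ℕ} (hN : N ≠ 0) (l : ℤ) :
    charFun (grid N) (2 * Real.pi * (N * l : ℤ)) = 1 := by
  rw [charFun_grid]
  have hN' : (N : ℂ) ≠ 0 := by exact_mod_cast hN
  have : ∀ j ∈ Finset.range N,
      Complex.exp ((2 * Real.pi * (N * l : ℤ) : ℝ) * ((j : ℝ) / N : ℝ) * Complex.I) = 1 := by
    intro j _
    rw [Complex.exp_eq_one_iff]
    refine ⟨l * j, ?_⟩
    push_cast
    field_simp
  rw [Finset.sum_congr rfl this]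
  simp [hN']

theorem charFun_grid_of_not_dvd {N : ℕ} {k : ℤ} (hk : ¬ (N : ℤ) ∣ k) :
    charFun (grid N) (2 * Real.pi * k) = 0 := by
  rw [charFun_grid]
  rcases Nat.eq_zero_or_pos N with h0 | h0
  · simp [h0]
  have hN' : (N : ℂ) ≠ 0 := by exact_mod_cast h0.ne'
  set z : ℂ := Complex.exp (2 * Real.pi * Complex.I * (k / N)) with hz
  have hpow : ∀ j : ℕ,
      Complex.exp ((2 * Real.pi * k : ℝ) * ((j : ℝ) / N : ℝ) * Complex.I) = z ^ j := by
    intro j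
    rw [hz, ← Complex.exp_nat_mul]
    congr 1
    push_cast
    ring
  simp_rw [hpow]
  have hzN : z ^ N = 1 := by
    rw [hz, ← Complex.exp_nat_mul, Complex.exp_eq_one_iff]
    exact ⟨k, by field_simp⟩
  have hz1 : z ≠ 1 := by
    intro h1
    rw [hz, Complex.exp_eq_one_iff] at h1
    obtain ⟨n, hn⟩ := h1
    apply hk
    refine ⟨n, ?_⟩
    rw [mul_comm (n : ℂ)] at hn
    have h2 := mul_left_cancel₀ Complex.two_pi_I_ne_zero hn
    rw [div_eq_iff hN'] at h2
    rw [mul_comm]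
    exact_mod_cast h2
  rw [geom_sum_eq hz1, hzN, sub_self, zero_div, mul_zero]

theorem conv_compl_eq_zero {γ β : Measure ℝ} [IsProbabilityMeasure γ] [IsProbabilityMeasure β]
    {P Q S : Set ℝ} (hS : MeasurableSet S) (hP : γ Pᶜ = 0) (hQ : β Qᶜ = 0)
    (h : ∀ x ∈ P, ∀ y ∈ Q, x + y ∈ S) : γ.conv β Sᶜ = 0 := by
  rw [conv_apply_eq γ β hS.compl]
  have h1 : ∀ᵐ p ∂γ.prod β, p.1 ∈ P := Measure.quasiMeasurePreserving_fst.ae hP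
  have h2 : ∀ᵐ p ∂γ.prod β, p.2 ∈ Q := Measure.quasiMeasurePreserving_snd.ae hQ
  have : ∀ᵐ p ∂γ.prod β, p.1 + p.2 ∈ S := by
    filter_upwards [h1, h2] with p hp hq using h _ hp _ hq
  exact this

theorem grid_compl (N : ℕ) : grid N {x | ∃ j : ℕ, j < N ∧ x = (j : ℝ) / N}ᶜ = 0 := by
  have hS : MeasurableSet {x : ℝ | ∃ j : ℕ, j < N ∧ x = (j : ℝ) / N} := by
    refine Set.Countable.measurableSet ((Set.countable_range fun j : ℕ => (j : ℝ) / N).mono ?_)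
    rintro x ⟨j, -, rfl⟩
    exact ⟨j, rfl⟩
  rw [grid_apply N hS.compl]
  refine mul_eq_zero.2 (Or.inr (Finset.sum_eq_zero fun j hj => ?_))
  rw [Set.indicator_of_notMem]
  intro hc
  exact hc ⟨j, Finset.mem_range.1 hj, rfl⟩

theorem chi_fract (k : ℤ) (x : ℝ) : chi k (Int.fract x) = chi k x := by
  have : chi k ((⌊x⌋ : ℤ) : ℝ) = 1 := by
    unfold chi
    rw [Complex.exp_eq_one_iff]
    exact ⟨k * ⌊x⌋, by push_cast; ring⟩
  conv_rhs => rw [← Int.fract_add_floor x, chi_add_right, this, mul_one]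

/-- Integer frequencies do not see integer parts, so x ↦ {Nx} retains exactly the coefficients at
multiples of N. -/
theorem charFun_map_fract (μ : Measure ℝ) (N : ℕ) (k : ℤ) :
    charFun (μ.map fun x => Int.fract ((N : ℝ) * x)) (2 * Real.pi * k)
      = charFun μ (2 * Real.pi * (N * k : ℤ)) := by
  rw [← integral_chi, ← integral_chi, integral_map (by fun_prop)
    (measurable_chi k).aestronglyMeasurable]
  congr 1
  ext x
  rw [chi_fract]
  unfold chi
  congr 1
  push_cast
  ring

/-- A measure on `[0, 1)` whose Fourier coefficients live on multiples of `N` is a convolution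
of the grid measure with a measure on `[0, 1/N)`. -/
theorem eq_grid_conv_map_fract {μ : Measure ℝ} [IsProbabilityMeasure μ]
    (hμ : μ (Set.Ico 0 1)ᶜ = 0) {N : ℕ} (hN : N ≠ 0)
    (h : ∀ k : ℤ, ¬ (N : ℤ) ∣ k → charFun μ (2 * Real.pi * k) = 0) :
    μ = (grid N).conv
      ((μ.map fun x => Int.fract ((N : ℝ) * x)).map fun x => (N : ℝ)⁻¹ * x) := by
  have := isProbabilityMeasure_grid hN
  have : IsProbabilityMeasure (μ.map fun x => Int.fract ((N : ℝ) * x)) :=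
    Measure.isProbabilityMeasure_map (by fun_prop)
  have : IsProbabilityMeasure
      ((μ.map fun x => Int.fract ((N : ℝ) * x)).map fun x => (N : ℝ)⁻¹ * x) :=
    Measure.isProbabilityMeasure_map (by fun_prop)
  have hN0 : (0 : ℝ) < N := by exact_mod_cast Nat.pos_of_ne_zero hN
  refine ext_of_charFun_two_pi hμ ?_ fun k => ?_
  -- Grid points are at most 1 - 1/N and the other summand is below 1/N, so the sum stays in [0, 1),
  -- as uniqueness requires.
  · refine conv_compl_eq_zero (Q := Set.Ico 0 (N : ℝ)⁻¹) measurableSet_Ico (grid_compl N) ?_ ?_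
    · rw [Measure.map_map (by fun_prop) (by fun_prop),
        Measure.map_apply (by fun_prop) measurableSet_Ico.compl]
      refine measure_mono_null (t := ∅) (fun x hx => hx ?_) measure_empty
      refine ⟨mul_nonneg (inv_nonneg.2 hN0.le) (Int.fract_nonneg _), ?_⟩
      exact mul_lt_of_lt_one_right (inv_pos.2 hN0) (Int.fract_lt_one _)
    · rintro x ⟨j, hj, rfl⟩ y hy
      constructor
      · exact add_nonneg (by positivity) hy.1
      · have h1 : (j : ℝ) + 1 ≤ N := by exact_mod_cast hj
        have h2 : (j : ℝ) / N + (N : ℝ)⁻¹ ≤ 1 := by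
          rw [← one_div, ← add_div, div_le_one hN0]; exact h1
        linarith [hy.2]
  · rw [charFun_conv, charFun_map_mul]
    by_cases hk : (N : ℤ) ∣ k
    · obtain ⟨l, rfl⟩ := hk
      rw [charFun_grid_of_dvd hN, one_mul]
      have : (N : ℝ)⁻¹ * (2 * Real.pi * (N * l : ℤ)) = 2 * Real.pi * l := by
        push_cast
        field_simp
      rw [this, charFun_map_fract]
    · rw [h k hk, charFun_grid_of_not_dvd hk, zero_mul]

/-! ### The decomposition step -/

/-- One step of the decomposition: the first factor splits off a grid measure, and after
rescaling the roles of the two factors are exchanged. -/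
structure IsStep (N : ℕ) (p q : Measure ℝ × Measure ℝ) : Prop where
  two_le : 2 ≤ N
  fst_eq : p.1 = (grid N).conv (q.2.map fun x => (N : ℝ)⁻¹ * x)
  snd_eq : p.2 = q.1.map fun x => (N : ℝ)⁻¹ * x

theorem IsFactorPair.exists_isStep {μ ν : Measure ℝ} (h : IsFactorPair μ ν)
    (h1 : charFun μ (2 * Real.pi * (1 : ℤ)) = 0) (hν : ν ≠ Measure.dirac 0) :
    ∃ (N : ℕ) (q : Measure ℝ × Measure ℝ), IsStep N (μ, ν) q ∧ IsFactorPair q.1 q.2 ∧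
      charFun q.1 (2 * Real.pi * (1 : ℤ)) = 0 := by
  have := h.left_prob
  have := h.right_prob
  have hex : ∃ n : ℕ, 0 < n ∧ charFun μ (2 * Real.pi * (n : ℤ)) ≠ 0 := by
    by_contra hc
    push Not at hc
    have hu : μ = unif 1 := by
      refine h.eq_unif_of_charFun fun k hk => ?_
      have hpos : 0 < k.natAbs := Int.natAbs_pos.2 hk
      rcases Int.natAbs_eq k with h2 | h2
      · rw [h2]; exact hc _ hpos
      · rw [h2, charFun_two_pi_neg_eq_zero]; exact hc _ hpos
    subst hu
    exact hν h.eq_dirac_of_eq_unif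
  classical
  obtain ⟨hN0, hNne⟩ := Nat.find_spec hex
  have hmin : ∀ k : ℕ, 0 < k → k < Nat.find hex → charFun μ (2 * Real.pi * (k : ℤ)) = 0 := by
    intro k hk hlt
    by_contra hc
    exact Nat.find_min hex hlt ⟨hk, hc⟩
  generalize Nat.find hex = N at hN0 hNne hmin
  have hN2 : 2 ≤ N := by
    by_contra hc
    have : N = 1 := by omega
    subst this
    exact hNne (by exact_mod_cast h1)
  have hNR : (0 : ℝ) < N := by exact_mod_cast hN0
  have hμ := eq_grid_conv_map_fract h.left_compl hN0.ne' fun k hk => by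
    by_contra hc
    exact hk (h.dvd_of_charFun_ne_zero hN0 hNne hmin hc)
  set μ' := μ.map fun x => Int.fract ((N : ℝ) * x) with hμ'
  set ν' := ν.map fun x => (N : ℝ) * x with hν'
  have : IsProbabilityMeasure μ' := Measure.isProbabilityMeasure_map (by fun_prop)
  have : IsProbabilityMeasure ν' := Measure.isProbabilityMeasure_map (by fun_prop)
  have : IsProbabilityMeasure (grid N) := isProbabilityMeasure_grid hN0.ne'
  have hνeq : ν = ν'.map fun x => (N : ℝ)⁻¹ * x := by
    rw [hν', Measure.map_map (by fun_prop) (by fun_prop)]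
    conv_lhs => rw [← Measure.map_id (μ := ν)]
    congr 1
    ext x
    simp [hNR.ne']
  have hcν : ∀ k : ℤ, charFun ν' (2 * Real.pi * k) = charFun ν (2 * Real.pi * (N * k : ℤ)) := by
    intro k
    rw [hν', charFun_map_mul]
    congr 1
    push_cast
    ring
  have hμ0 : μ' (Set.Iio 0) = 0 := by
    rw [hμ', Measure.map_apply (by fun_prop) measurableSet_Iio]
    refine measure_mono_null (t := ∅) (fun x hx => ?_) measure_empty
    exact absurd (show Int.fract ((N : ℝ) * x) < 0 from hx) (not_lt.2 (Int.fract_nonneg _))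
  have hν0 : ν' (Set.Iio 0) = 0 := by
    rw [hν', Measure.map_apply (by fun_prop) measurableSet_Iio]
    refine measure_mono_null ?_ h.right_nonneg
    intro x hx
    simp only [Set.mem_preimage, Set.mem_Iio] at hx ⊢
    by_contra hc
    exact absurd hx (not_lt.2 (mul_nonneg hNR.le (not_lt.1 hc)))
  have hge : ν'.conv μ' (Set.Ici 0)ᶜ = 0 :=
    conv_compl_eq_zero measurableSet_Ici (P := Set.Ici 0) (Q := Set.Ici 0)
      (by rwa [Set.compl_Ici]) (by rwa [Set.compl_Ici]) fun x hx y hy => Set.mem_Ici.2 (add_nonneg hx hy)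
  -- Fourier coefficients only determine the sum modulo 1, so a bound by 1 is needed. The top grid
  -- atom (N - 1)/N has positive mass; any mass of `ρ` on [1/N, ∞) would make the uniform law charge
  -- [1, ∞).
  have hlt : ν'.conv μ' (Set.Ici 1) = 0 := by
    set ρ := (ν'.conv μ').map fun x => (N : ℝ)⁻¹ * x with hρ
    have : IsProbabilityMeasure (ν'.conv μ') := inferInstance
    have : IsProbabilityMeasure ρ := Measure.isProbabilityMeasure_map (by fun_prop)
    have hu : unif 1 = (grid N).conv ρ := by
      have : IsProbabilityMeasure (μ'.map fun x => (N : ℝ)⁻¹ * x) :=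
        Measure.isProbabilityMeasure_map (by fun_prop)
      refine Measure.ext_of_charFun (funext fun t => ?_)
      have hνt : charFun ν t = charFun ν' ((N : ℝ)⁻¹ * t) := by
        rw [hν', charFun_map_mul, mul_inv_cancel_left₀ hNR.ne']
      have hμt : charFun μ t = charFun (grid N) t * charFun μ' ((N : ℝ)⁻¹ * t) := by
        rw [hμ, charFun_conv, charFun_map_mul]
      have hρt : charFun ρ t = charFun (ν'.conv μ') ((N : ℝ)⁻¹ * t) := charFun_map_mul _ _
      rw [← h.conv_eq, charFun_conv, charFun_conv, hνt, hμt, hρt, charFun_conv]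
      ring
    have h2 : (grid N).prod ρ ({((N - 1 : ℕ) : ℝ) / N} ×ˢ Set.Ici ((N : ℝ)⁻¹)) = 0 := by
      have h3 : unif 1 (Set.Ici 1) = 0 := by
        refine measure_mono_null ?_ unif_one_compl
        intro x hx hx'
        exact absurd hx'.2 (not_lt.2 hx)
      rw [hu, conv_apply_eq _ _ measurableSet_Ici] at h3
      refine measure_mono_null ?_ h3
      rintro ⟨x, y⟩ ⟨hx, hy⟩
      simp only [Set.mem_singleton_iff, Set.mem_Ici, Set.mem_preimage] at *
      rw [hx, Nat.cast_sub (by omega)]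
      have : ((N : ℝ) - (1 : ℕ)) / N + (N : ℝ)⁻¹ = 1 := by
        field_simp
        simp
      linarith
    rw [Measure.prod_prod, mul_eq_zero] at h2
    rcases h2 with h2 | h2
    · exfalso
      rw [grid_apply N (measurableSet_singleton _), mul_eq_zero, Finset.sum_eq_zero_iff] at h2
      rcases h2 with h2 | h2
      · simp at h2
      · have := h2 (N - 1) (Finset.mem_range.2 (by omega))
        simp at this
    · rw [hρ, Measure.map_apply (by fun_prop) measurableSet_Ici] at h2
      refine measure_mono_null ?_ h2
      intro x hx
      simp only [Set.mem_preimage, Set.mem_Ici] at hx ⊢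
      exact le_mul_of_one_le_right (inv_nonneg.2 hNR.le) hx
  have hpair : IsFactorPair ν' μ' := by
    refine ⟨inferInstance, inferInstance, hν0, hμ0, ?_⟩
    refine ext_of_charFun_two_pi ?_ unif_one_compl fun k => ?_
    · refine measure_mono_null (t := (Set.Ici 0)ᶜ ∪ Set.Ici 1) ?_ (measure_union_null hge hlt)
      intro x hx
      by_cases h0 : 0 ≤ x
      · right
        by_contra hc
        exact hx ⟨h0, not_le.1 hc⟩
      · exact Or.inl h0
    · by_cases hk : k = 0
      · simp [hk]
      · rw [charFun_unif_one hk, charFun_conv, hcν, charFun_map_fract, mul_comm, mul_eq_zero]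
        exact h.charFun_mul_eq_zero (mul_ne_zero (by exact_mod_cast hN0.ne') hk)
  refine ⟨N, (ν', μ'), ⟨hN2, hμ, hνeq⟩, hpair, ?_⟩
  -- The first coefficient of `ν'` is ν̂(N), which vanishes because μ̂(N) ≠ 0; this lets the step be
  -- repeated.
  rw [hcν, mul_one]
  exact (h.charFun_mul_eq_zero (by exact_mod_cast hN0.ne')).resolve_left hNne

/-! ### Rescaled factors and finite convolutions -/

theorem unif_eq_map {c : ℝ} (hc : 0 < c) : unif c = (unif 1).map fun x => c * x := by
  have h1 : (unif 1).map (fun x => c * x)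
      = (volume.map fun x : ℝ => c * x).restrict (Set.Icc 0 c) := by
    rw [Measure.restrict_map (by fun_prop) measurableSet_Icc, unif_one]
    congr 2
    ext x
    simp only [Set.mem_Icc, Set.mem_preimage]
    rw [mul_nonneg_iff_of_pos_left hc, mul_le_iff_le_one_right hc]
  rw [h1, Real.map_volume_mul_left hc.ne', Measure.restrict_smul, unif, ProbabilityTheory.cond,
    Real.volume_Icc, sub_zero, abs_of_pos (inv_pos.2 hc), ENNReal.ofReal_inv_of_pos hc]

theorem isProbabilityMeasure_unif {c : ℝ} (hc : 0 < c) : IsProbabilityMeasure (unif c) := by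
  rw [unif_eq_map hc]
  exact Measure.isProbabilityMeasure_map (by fun_prop)

theorem charFun_unif {c : ℝ} (hc : 0 < c) (t : ℝ) : charFun (unif c) t = charFun (unif 1) (c * t) := by
  rw [unif_eq_map hc, charFun_map_mul]

/-- The uniform distribution on `[0, 1]` splits off a grid measure. -/
theorem charFun_unif_one_eq {N : ℕ} (hN : N ≠ 0) (t : ℝ) :
    charFun (unif 1) t = charFun (grid N) t * charFun (unif 1) ((N : ℝ)⁻¹ * t) := by
  have := isProbabilityMeasure_grid hN
  have : IsProbabilityMeasure ((unif 1).map fun x => Int.fract ((N : ℝ) * x)) :=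
    Measure.isProbabilityMeasure_map (by fun_prop)
  have h1 := eq_grid_conv_map_fract unif_one_compl hN fun k hk =>
    charFun_unif_one (fun h0 => hk (h0 ▸ dvd_zero _))
  have h2 : (unif 1).map (fun x => Int.fract ((N : ℝ) * x)) = unif 1 := by
    refine ext_of_charFun_two_pi ?_ unif_one_compl fun k => ?_
    · rw [Measure.map_apply (by fun_prop) measurableSet_Ico.compl]
      refine measure_mono_null (t := ∅) (fun x hx => hx ?_) measure_empty
      exact ⟨Int.fract_nonneg _, Int.fract_lt_one _⟩
    · rw [charFun_map_fract]
      by_cases hk : k = 0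
      · simp [hk]
      · rw [charFun_unif_one hk, charFun_unif_one (mul_ne_zero (by exact_mod_cast hN) hk)]
  rw [h2] at h1
  have : IsProbabilityMeasure ((unif 1).map fun x => (N : ℝ)⁻¹ * x) :=
    Measure.isProbabilityMeasure_map (by fun_prop)
  conv_lhs => rw [h1, charFun_conv, charFun_map_mul]

theorem scale_succ (N : ℕ → ℕ) (k : ℕ) : scale N (k + 1) = scale N k * N (k + 1) := by
  rw [scale, scale, Finset.prod_Icc_succ_top (by omega)]

theorem two_pow_le_scale {N : ℕ → ℕ} (hN : ∀ k, 1 ≤ k → 2 ≤ N k) (k : ℕ) :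
    (2 : ℝ) ^ k ≤ scale N k := by
  induction k with
  | zero => simp [scale]
  | succ k ih =>
    rw [scale_succ, pow_succ]
    have : (2 : ℝ) ≤ N (k + 1) := by exact_mod_cast hN (k + 1) (by omega)
    exact mul_le_mul ih this (by norm_num) (le_trans (by positivity) ih)

theorem scale_pos {N : ℕ → ℕ} (hN : ∀ k, 1 ≤ k → 2 ≤ N k) (k : ℕ) : 0 < scale N k :=
  lt_of_lt_of_le (by positivity) (two_pow_le_scale hN k)

/-- The factor with index k + 1 is the grid of N_{k+1} points shrunk by N_1 ⋯ N_k, which is the form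
the decomposition steps produce. -/
theorem charFun_factor (N : ℕ → ℕ) (k : ℕ) (t : ℝ) :
    charFun (factor N (k + 1)) t = charFun (grid (N (k + 1))) ((scale N k)⁻¹ * t) := by
  rw [← charFun_map_mul]
  congr 1
  rw [factor, grid, Measure.map_smul, Measure.map_finset_sum (by fun_prop)]
  congr 1
  refine Finset.sum_congr rfl fun j _ => ?_
  rw [Measure.map_dirac' (by fun_prop), scale_succ]
  congr 1
  rw [div_mul_eq_div_div, div_right_comm, div_eq_inv_mul (_ / _)]

theorem isProbabilityMeasure_finConv {ρ : ℕ → Measure ℝ} (hρ : ∀ i, IsProbabilityMeasure (ρ i))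
    (n : ℕ) : IsProbabilityMeasure (finConv ρ n) := by
  induction n with
  | zero => rw [finConv]; infer_instance
  | succ n ih => rw [finConv]; infer_instance

theorem isProbabilityMeasure_factor {N : ℕ → ℕ} (hN : ∀ k, 1 ≤ k → 2 ≤ N k) {k : ℕ}
    (hk : 1 ≤ k) : IsProbabilityMeasure (factor N k) :=
  isProbabilityMeasure_smul_sum_dirac (by have := hN k hk; omega) _

theorem isProbabilityMeasure_finConv_odd {N : ℕ → ℕ} (hN : ∀ k, 1 ≤ k → 2 ≤ N k) (n : ℕ) :
    IsProbabilityMeasure (finConv (oddFactor N) n) :=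
  isProbabilityMeasure_finConv (fun _ => isProbabilityMeasure_factor hN (by omega)) n

theorem isProbabilityMeasure_finConv_even {N : ℕ → ℕ} (hN : ∀ k, 1 ≤ k → 2 ≤ N k) (n : ℕ) :
    IsProbabilityMeasure (finConv (evenFactor N) n) :=
  isProbabilityMeasure_finConv (fun _ => isProbabilityMeasure_factor hN (by omega)) n

theorem charFun_finConv_odd_succ {N : ℕ → ℕ} (hN : ∀ k, 1 ≤ k → 2 ≤ N k) (k : ℕ) (t : ℝ) :
    charFun (finConv (oddFactor N) (k + 1)) t = charFun (finConv (oddFactor N) k) t *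
      charFun (grid (N (2 * k + 1))) ((scale N (2 * k))⁻¹ * t) := by
  have := isProbabilityMeasure_finConv_odd hN k
  have : IsProbabilityMeasure (oddFactor N k) := isProbabilityMeasure_factor hN (by omega)
  rw [finConv, charFun_conv, oddFactor, charFun_factor]

theorem charFun_finConv_even_succ {N : ℕ → ℕ} (hN : ∀ k, 1 ≤ k → 2 ≤ N k) (k : ℕ) (t : ℝ) :
    charFun (finConv (evenFactor N) (k + 1)) t = charFun (finConv (evenFactor N) k) t *
      charFun (grid (N (2 * k + 2))) ((scale N (2 * k + 1))⁻¹ * t) := by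
  have := isProbabilityMeasure_finConv_even hN k
  have : IsProbabilityMeasure (evenFactor N k) := isProbabilityMeasure_factor hN (by omega)
  rw [finConv, charFun_conv, evenFactor, charFun_factor]

theorem IsStep.charFun_fst {N : ℕ} {p q : Measure ℝ × Measure ℝ} (h : IsStep N p q)
    (hq : IsFactorPair q.1 q.2) (t : ℝ) :
    charFun p.1 t = charFun (grid N) t * charFun q.2 ((N : ℝ)⁻¹ * t) := by
  have := hq.right_prob
  have : IsProbabilityMeasure (q.2.map fun x => (N : ℝ)⁻¹ * x) :=
    Measure.isProbabilityMeasure_map (by fun_prop)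
  have := isProbabilityMeasure_grid (N := N) (by have := h.two_le; omega)
  rw [h.fst_eq, charFun_conv, charFun_map_mul]

theorem IsStep.charFun_snd {N : ℕ} {p q : Measure ℝ × Measure ℝ} (h : IsStep N p q) (t : ℝ) :
    charFun p.2 t = charFun q.1 ((N : ℝ)⁻¹ * t) := by
  rw [h.snd_eq, charFun_map_mul]

theorem inv_scale_succ_mul (N : ℕ → ℕ) (k : ℕ) (t : ℝ) :
    (N (k + 1) : ℝ)⁻¹ * ((scale N k)⁻¹ * t) = (scale N (k + 1))⁻¹ * t := by
  rw [scale_succ, mul_inv]; ring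

/-! ### Iteration and the limit -/

/-- The effect of `2k` decomposition steps. -/
theorem charFun_eq_of_isStep {N : ℕ → ℕ} (hN : ∀ k, 1 ≤ k → 2 ≤ N k)
    {q : ℕ → Measure ℝ × Measure ℝ} (hq : ∀ n, IsFactorPair (q n).1 (q n).2) (k : ℕ)
    (hs : ∀ n, n < 2 * k → IsStep (N (n + 1)) (q n) (q (n + 1))) (t : ℝ) :
    charFun (q 0).1 t
        = charFun (finConv (oddFactor N) k) t * charFun (q (2 * k)).1 ((scale N (2 * k))⁻¹ * t) ∧
      charFun (q 0).2 t
        = charFun (finConv (evenFactor N) k) t *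
          charFun (q (2 * k)).2 ((scale N (2 * k))⁻¹ * t) := by
  induction k with
  | zero => simp [finConv, scale]
  | succ k ih =>
    obtain ⟨ih1, ih2⟩ := ih fun n hn => hs n (by omega)
    have s1 := hs (2 * k) (by omega)
    have s2 := hs (2 * k + 1) (by omega)
    constructor
    · rw [ih1, charFun_finConv_odd_succ hN, s1.charFun_fst (hq _), s2.charFun_snd,
        inv_scale_succ_mul, inv_scale_succ_mul, mul_assoc, mul_add_one]
    · rw [ih2, charFun_finConv_even_succ hN, s1.charFun_snd, inv_scale_succ_mul,
        s2.charFun_fst (hq _), inv_scale_succ_mul, mul_assoc, mul_add_one]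

theorem norm_charFun_sub_one_le {α : Measure ℝ} [IsProbabilityMeasure α]
    (hα : α (Set.Ico 0 1)ᶜ = 0) (t : ℝ) : ‖charFun α t - 1‖ ≤ |t| := by
  have hint : Integrable (fun x : ℝ => Complex.exp (t * x * Complex.I)) α := by
    refine Integrable.of_bound (by fun_prop) 1 (ae_of_all _ fun x => ?_)
    rw [← Complex.ofReal_mul, Complex.norm_exp_ofReal_mul_I]
  have h1 : charFun α t - 1 = ∫ x : ℝ, (Complex.exp (t * x * Complex.I) - 1) ∂α := by
    rw [integral_sub hint (integrable_const _), charFun_apply_real]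
    simp
  rw [h1]
  refine (norm_integral_le_of_norm_le_const (C := |t|) ?_).trans_eq (by simp)
  have : ∀ᵐ x ∂α, x ∈ Set.Ico (0 : ℝ) 1 := hα
  filter_upwards [this] with x hx
  have := Real.norm_exp_I_mul_ofReal_sub_one_le (x := t * x)
  rw [mul_comm Complex.I, Complex.ofReal_mul] at this
  refine this.trans ?_
  rw [Real.norm_eq_abs, abs_mul, abs_of_nonneg hx.1]
  exact mul_le_of_le_one_right (abs_nonneg t) hx.2.le

/-- The remainder after k factors is a law on [0, 1) shrunk by at least 2^k, so its characteristic
function tends to 1 pointwise. Lévy's continuity theorem turns this into weak convergence. -/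
theorem isInfiniteConv_of_charFun {N : ℕ → ℕ} (hN : ∀ k, 1 ≤ k → 2 ≤ N k) {ρ r : ℕ → Measure ℝ}
    {m : Measure ℝ} [IsProbabilityMeasure m] (hρ : ∀ n, IsProbabilityMeasure (finConv ρ n))
    (hr : ∀ n, IsProbabilityMeasure (r n)) (hr' : ∀ n, r n (Set.Ico 0 1)ᶜ = 0)
    (h : ∀ k t, charFun m t = charFun (finConv ρ k) t * charFun (r k) ((scale N (2 * k))⁻¹ * t)) :
    IsInfiniteConv ρ m := by
  let P : ℕ → ProbabilityMeasure ℝ := fun n => ⟨finConv ρ n, hρ n⟩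
  let p : ProbabilityMeasure ℝ := ⟨m, inferInstance⟩
  refine ⟨P, p, fun _ => rfl, rfl, ProbabilityMeasure.tendsto_iff_tendsto_charFun.2 fun t => ?_⟩
  rw [tendsto_iff_norm_sub_tendsto_zero]
  have hlim : Tendsto (fun k : ℕ => (1 / 2 : ℝ) ^ k * |t|) atTop (𝓝 0) := by
    simpa using (tendsto_pow_atTop_nhds_zero_of_lt_one (r := (1 / 2 : ℝ)) (by norm_num)
      (by norm_num)).mul_const |t|
  refine squeeze_zero (fun _ => norm_nonneg _) (fun k => ?_) hlim
  have h1 : charFun (finConv ρ k) t - charFun m t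
      = - (charFun (finConv ρ k) t * (charFun (r k) ((scale N (2 * k))⁻¹ * t) - 1)) := by
    rw [h k t]; ring
  change ‖charFun (finConv ρ k) t - charFun m t‖ ≤ _
  rw [h1, norm_neg, norm_mul]
  refine (mul_le_of_le_one_left (norm_nonneg _) (norm_charFun_le_one _)).trans ?_
  refine (norm_charFun_sub_one_le (hr' k) _).trans ?_
  rw [abs_mul, abs_of_pos (inv_pos.2 (scale_pos hN _))]
  refine mul_le_mul_of_nonneg_right ?_ (abs_nonneg t)
  rw [one_div, inv_pow]
  refine inv_anti₀ (by positivity) (le_trans ?_ (two_pow_le_scale hN _))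
  exact pow_le_pow_right₀ (by norm_num) (by omega)

theorem charFun_dirac_zero (t : ℝ) : charFun (Measure.dirac (0 : ℝ)) t = 1 := by
  rw [charFun_dirac]; simp

/-- A factor pair whose first factor has vanishing first Fourier coefficient is natural or
trivial. -/
theorem IsFactorPair.isNaturalComplementaryPair {μ ν : Measure ℝ} (h : IsFactorPair μ ν)
    (h1 : charFun μ (2 * Real.pi * (1 : ℤ)) = 0) :
    IsNaturalComplementaryPair μ ν ∨ (μ = unif 1 ∧ ν = Measure.dirac 0) := by
  classical
  let T := {p : Measure ℝ × Measure ℝ //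
    IsFactorPair p.1 p.2 ∧ charFun p.1 (2 * Real.pi * (1 : ℤ)) = 0}
  -- Once the second measure is δ_0 the step is idle; the default 2 keeps every `N k` admissible.
  have hstep : ∀ p : T, ∃ r : ℕ × T, 2 ≤ r.1 ∧
      (p.1.2 ≠ Measure.dirac 0 → IsStep r.1 p.1 r.2.1) := by
    intro p
    by_cases hp : p.1.2 = Measure.dirac 0
    · exact ⟨(2, p), le_rfl, fun hc => absurd hp hc⟩
    · obtain ⟨N, q, hs, hq⟩ := p.2.1.exists_isStep p.2.2 hp
      exact ⟨(N, ⟨q, hq⟩), hs.two_le, fun _ => hs⟩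
  choose step hstep2 hstepS using hstep
  let s : ℕ → T := fun n => (fun p => (step p).2)^[n] ⟨(μ, ν), h, h1⟩
  -- The shift makes `N (n + 1)` the grid size removed in passing from `q n` to `q (n + 1)`.
  let N : ℕ → ℕ := fun k => (step (s (k - 1))).1
  let q : ℕ → Measure ℝ × Measure ℝ := fun n => (s n).1
  have hN : ∀ k, 1 ≤ k → 2 ≤ N k := fun k _ => hstep2 _
  have hq : ∀ n, IsFactorPair (q n).1 (q n).2 := fun n => (s n).2.1
  have hS : ∀ n, (q n).2 ≠ Measure.dirac 0 → IsStep (N (n + 1)) (q n) (q (n + 1)) := by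
    intro n hn
    have : s (n + 1) = (step (s n)).2 := Function.iterate_succ_apply' _ _ _
    simp only [q, N, this, Nat.add_sub_cancel]
    exact hstepS _ hn
  have hμ := h.left_prob
  have hν := h.right_prob
  have hco := isProbabilityMeasure_finConv_odd hN
  have hce := isProbabilityMeasure_finConv_even hN
  by_cases hex : ∃ n, (q n).2 = Measure.dirac 0
  · have hlast := Nat.find_spec hex
    have hbefore : ∀ n, n < Nat.find hex → IsStep (N (n + 1)) (q n) (q (n + 1)) :=
      fun n hn => hS n (Nat.find_min hex hn)
    generalize Nat.find hex = n at hlast hbefore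
    have hunif : (q n).1 = unif 1 := by
      have := hq n
      rw [hlast] at this
      exact this.eq_unif_of_eq_dirac
    rcases Nat.eq_zero_or_pos n with h0 | hpos
    · subst h0
      exact Or.inr ⟨hunif, hlast⟩
    refine Or.inl ⟨h.conv_eq, N, hN, Or.inl ?_⟩
    rcases Nat.even_or_odd' n with ⟨k, rfl | rfl⟩
    · refine ⟨k, by omega, Or.inr ⟨?_, ?_⟩⟩
      · have hc : 0 < 1 / scale N (2 * k) := one_div_pos.2 (scale_pos hN _)
        have := isProbabilityMeasure_unif hc
        refine Measure.ext_of_charFun (funext fun t => ?_)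
        rw [charFun_conv, charFun_unif hc, one_div, ← hunif]
        exact (charFun_eq_of_isStep hN hq k hbefore t).1
      · refine Measure.ext_of_charFun (funext fun t => ?_)
        have := (charFun_eq_of_isStep hN hq k hbefore t).2
        rwa [hlast, charFun_dirac_zero, mul_one] at this
    -- After an odd number of steps the uniform remainder belongs to `ν`, which is one grid short of
    -- Type I; the uniform law itself supplies a further grid of `N (2 * k + 2)` points.
    · have hk := charFun_eq_of_isStep hN hq k fun n hn => hbefore n (by omega)
      have hst := hbefore (2 * k) (by omega)
      refine ⟨k + 1, by omega, Or.inl ⟨?_, ?_⟩⟩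
      · refine Measure.ext_of_charFun (funext fun t => ?_)
        have := (hk t).1
        rwa [hst.charFun_fst (hq _), hlast, charFun_dirac_zero, mul_one,
          ← charFun_finConv_odd_succ hN] at this
      · have hc : 0 < 1 / scale N (2 * (k + 1)) := one_div_pos.2 (scale_pos hN _)
        have := isProbabilityMeasure_unif hc
        refine Measure.ext_of_charFun (funext fun t => ?_)
        have := (hk t).2
        rw [hst.charFun_snd, inv_scale_succ_mul, hunif,
          charFun_unif_one_eq (N := N (2 * k + 2)) (by have := hN (2 * k + 2) (by omega); omega),
          inv_scale_succ_mul, ← mul_assoc, ← charFun_finConv_even_succ hN] at this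
        rw [charFun_conv, charFun_unif hc, one_div]
        exact this
  · push Not at hex
    refine Or.inl ⟨h.conv_eq, N, hN, Or.inr ⟨?_, ?_⟩⟩
    · exact isInfiniteConv_of_charFun hN hco (fun n => (hq (2 * n)).left_prob)
        (fun n => (hq (2 * n)).left_compl)
        fun k t => (charFun_eq_of_isStep hN hq k (fun n _ => hS n (hex n)) t).1
    · exact isInfiniteConv_of_charFun hN hce (fun n => (hq (2 * n)).right_prob)
        (fun n => (hq (2 * n)).symm.left_compl)
        fun k t => (charFun_eq_of_isStep hN hq k (fun n _ => hS n (hex n)) t).2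

end LebesgueFactorization

theorem theorem2p1 (μ ν : Measure ℝ) [IsProbabilityMeasure μ] [IsProbabilityMeasure ν]
    (hμ : μ (Set.Icc (0 : ℝ) 1)ᶜ = 0) (hν : ν (Set.Icc (0 : ℝ) 1)ᶜ = 0)
    (hconv : LebesgueFactorization.IsComplementaryPair μ ν) :
    LebesgueFactorization.IsNaturalComplementaryPair μ ν ∨
      LebesgueFactorization.IsNaturalComplementaryPair ν μ ∨
      (μ = Measure.dirac 0 ∧ ν = LebesgueFactorization.unif 1) ∨
      (ν = Measure.dirac 0 ∧ μ = LebesgueFactorization.unif 1) := by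
  have hsub : Set.Iio (0 : ℝ) ⊆ (Set.Icc (0 : ℝ) 1)ᶜ := fun x hx hx' =>
    absurd hx'.1 (not_le.2 hx)
  have h : LebesgueFactorization.IsFactorPair μ ν :=
    ⟨inferInstance, inferInstance, measure_mono_null hsub hμ, measure_mono_null hsub hν, hconv⟩
  -- The measure whose coefficient at 1 vanishes is the one that contains ν_1, or is uniform in the
  -- trivial case.
  rcases h.charFun_mul_eq_zero one_ne_zero with h1 | h1
  · rcases h.isNaturalComplementaryPair h1 with h2 | ⟨h2, h3⟩
    · exact Or.inl h2
    · exact Or.inr (Or.inr (Or.inr ⟨h3, h2⟩))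
  · rcases h.symm.isNaturalComplementaryPair h1 with h2 | ⟨h2, h3⟩
    · exact Or.inr (Or.inl h2)
    · exact Or.inr (Or.inr (Or.inl ⟨h3, h2⟩))
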